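/- **Definitions.** Let $G$ be a group. A *$G$-data* consists of subgroups $H_1,\dots,H_s\le G$ of finite indices $m_i=[G:H_i]$ and homomorphisms $f_i:H_i\to G$. It is *simple* if the only normal subgroup $K$ of $G$ with $K\le\bigcap_i H_i$ and $f_i(K)\le K$ for all $i$ is the trivial one; then $G$ is called *self-similar of orbit-type $(m_1,\dots,m_s)$*. Let $H_{\omega_i}$ be the largest subgroup $K\le H_i$ with $f_i(K)\le K$. Given right transversals $T_i\ni 1$ of $H_i$ in $G$, a subset $U\subseteq G$ is *closed under states* if $f_i(txt'^{-1})\in U$ whenever $x\in U$, $t,t'\in T_i$ and $H_it'=H_itx$. The group $G$ is *finite-state* with respect to the data if for some choice of such transversals every element of $G$ lies in a finite subset closed under states. Let $\mathcal A_n$ be the automorphism group of the rooted $n$-regular tree. A subgroup of $\mathcal A_n$ is *self-similar* if it contains all states of its elements, and *finite-state* if each of its elements has only finitely many states. For an abelian group $A$ put $$\mathcal G_A=A^{((H_{\omega_1}\backslash G)\times\cdots\times(H_{\omega_s}\backslash G))}\rtimes G^s,$$ where the base group is the direct sum of copies of $A$ indexed by the product of the sets of cosets $H_{\omega_i}x$,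 and $G^s$ permutes the copies by componentwise right translation of the cosets. **Theorem B.** Let $G$ be a group with a simple data $(H_i,f_i)_{1\le i\le s}$, of indices $\mathbf m=(m_1,\dots,m_s)$. 1. Let $A$ be a finitely generated abelian group and suppose that $G$ is not a torsion group. Then $\mathcal G_A$ is self-similar: it has a simple data, and for some $n\ge 2$ it is isomorphic to a self-similar subgroup of $\mathcal A_n$. If $G$ is finite-state with respect to its data, then the data of $\mathcal G_A$ can be chosen such that $\mathcal G_A$ is finite-state with respect to it, and the self-similar subgroup of $\mathcal A_n$ can be chosen finite-state. 2. Suppose that $s\ge1$, that $m_1=\dots=m_s=m$ and that $m=[G:\bigcap_iH_i]$. (i) If $B$ is a finite abelian group, then $\mathcal G_B$ is self-similar of orbit-type $(|B|\cdot m^s,\dots,|B|\cdot m^s)$ ($s$ entries). (ii) If $G$ is not a torsion group, then $\mathcal G_{\mathbb Z}$ is self-similar of orbit-type $(m^s,\dots,m^s,1)$ ($s$ entries $m^s$). In both cases, if $G$ is finite-state with respect to its data, then the data of this orbit-type can be chosen such that $\mathcal G_B$, respectively $\mathcal G_{\mathbb Z}$, is finite-state with respect to it. -/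

import Mathlib

/-! ### The rooted regular tree, states of automorphisms, self-similar groups -/

/-- The automorphism group of the rooted tree whose vertices are the words over the alphabet `Y`:
the permutations of the words that preserve the level (the length) and the prefix order. -/
def TreeAut (Y : Type*) : Subgroup (Equiv.Perm (List Y)) where
  carrier := {a | (∀ u, (a u).length = u.length) ∧ ∀ u v, u <+: v → a u <+: a v}
  one_mem' := ⟨fun _ => rfl, fun _ _ h => h⟩
  mul_mem' := by
    rintro a b ⟨ha, ha'⟩ ⟨hb, hb'⟩
    exact ⟨fun u => by simp [ha, hb], fun u v h => ha' _ _ (hb' _ _ h)⟩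
  inv_mem' := by
    rintro a ⟨ha, ha'⟩
    have hl : ∀ u, (a⁻¹ u).length = u.length := fun u => by
      have := ha (a⁻¹ u)
      simpa using this.symm
    refine ⟨hl, fun u v h => ?_⟩
    have h1 : a ((a⁻¹ v).take u.length) <+: v := by
      simpa using ha' _ _ (List.take_prefix u.length (a⁻¹ v))
    have h2 : (a ((a⁻¹ v).take u.length)).length = u.length := by
      rw [ha, List.length_take, hl]
      exact min_eq_left h.length_le
    have h3 : a ((a⁻¹ v).take u.length) = u :=
      (List.prefix_of_prefix_length_le h1 h h2.le).eq_of_length h2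
    have h4 : a⁻¹ u = (a⁻¹ v).take u.length := by
      rw [Equiv.Perm.inv_eq_iff_eq, h3]
    rw [h4]
    exact List.take_prefix _ _

namespace TreeAut

variable {Y : Type*}

theorem length_apply (a : TreeAut Y) (u : List Y) : (a.1 u).length = u.length := a.2.1 u

theorem apply_append (a : TreeAut Y) (u w : List Y) :
    a.1 u ++ (a.1 (u ++ w)).drop u.length = a.1 (u ++ w) := by
  obtain ⟨t, ht⟩ := a.2.2 u (u ++ w) (List.prefix_append u w)
  rw [← ht, ← length_apply a u, List.drop_left]

/-- The state of the tree automorphism `a` at the vertex `u`: the automorphism `a_u` determined by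
`a (u w) = a (u) a_u (w)` for all words `w`. -/
def state (a : TreeAut Y) (u : List Y) : TreeAut Y :=
  ⟨{ toFun := fun w => (a.1 (u ++ w)).drop u.length
     invFun := fun w => ((a⁻¹).1 (a.1 u ++ w)).drop u.length
     left_inv := fun w => by
       have := apply_append a u w
       simp [this]
     right_inv := fun w => by
       have h1 := apply_append a⁻¹ (a.1 u) w
       have h2 : (a⁻¹).1 (a.1 u) = u := by simp
       rw [h2, length_apply] at h1
       simp only [h1]
       have h3 : a.1 ((a⁻¹).1 (a.1 u ++ w)) = a.1 u ++ w := by simp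
       rw [h3, ← length_apply a u, List.drop_left] },
   fun w => by simp [length_apply], fun v w h => by
     have h1 : u ++ v <+: u ++ w := (List.prefix_append_right_inj u).2 h
     exact (a.2.2 _ _ h1).drop _⟩

/-- The set `Q(a)` of all states of `a`. -/
def states (a : TreeAut Y) : Set (TreeAut Y) := Set.range (state a)

/-- A tree automorphism is finite-state if it has only finitely many states. -/
def IsFiniteState (a : TreeAut Y) : Prop := (states a).Finite

/-- A group of tree automorphisms is self-similar (state-closed) if it contains all states of its
elements. -/
def IsSelfSimilar (K : Subgroup (TreeAut Y)) : Prop := ∀ a ∈ K, states a ⊆ (K : Set (TreeAut Y))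

end TreeAut

/-! ### Data for a group -/

/-- `G`-data: subgroups `H 0, …, H (s - 1)` of finite index in `G`, with virtual endomorphisms
`f i : H i → G`. -/
structure GData (G : Type*) [Group G] (s : ℕ) where
  H : Fin s → Subgroup G
  finiteIndex : ∀ i, (H i).FiniteIndex
  f : ∀ i, H i →* G

namespace GData

variable {G : Type*} [Group G] {s : ℕ} (D : GData G s)

/-- `K` is contained in `H i` and invariant under `f i`. -/
def Invariant (i : Fin s) (K : Subgroup G) : Prop :=
  K ≤ D.H i ∧ (K.subgroupOf (D.H i)).map (D.f i) ≤ K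

/-- The core of the data: the largest normal subgroup of `G` contained in all `H i` and invariant
under all `f i`. -/
def core : Subgroup G := sSup {K | K.Normal ∧ ∀ i, D.Invariant i K}

/-- Simple data: the core is trivial. -/
def IsSimple : Prop := D.core = ⊥

/-- The data have orbit-type `m` when `m i` is the index of `H i`. -/
def HasOrbitType (m : Fin s → ℕ) : Prop := ∀ i, (D.H i).index = m i

/-- The subgroup `H_{ω i}`: the largest subgroup of `H i` that is invariant under `f i`. -/
def parabolic (i : Fin s) : Subgroup G := sSup {K | D.Invariant i K}

/-- `T i` is a right transversal of `H i` in `G` that contains the identity, for every `i`. -/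
def IsTransversal (T : Fin s → Set G) : Prop :=
  ∀ i, Subgroup.IsComplement (D.H i : Set G) (T i) ∧ 1 ∈ T i

/-- A subset of `G` is closed under taking states with respect to the transversals `T i`: it
contains `f i (t x t'⁻¹)` for each of its elements `x`, where `t, t' ∈ T i` satisfy
`H i t' = H i t x`. -/
def StatesClosed (T : Fin s → Set G) (U : Set G) : Prop :=
  ∀ x ∈ U, ∀ i, ∀ t ∈ T i, ∀ t' ∈ T i, ∀ h : t * x * t'⁻¹ ∈ D.H i, D.f i ⟨t * x * t'⁻¹, h⟩ ∈ U

/-- `G` is finite-state with respect to the data: for suitable transversals every element of `G`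
lies in a finite subset that is closed under taking states. -/
def IsFiniteState : Prop :=
  ∃ T : Fin s → Set G, D.IsTransversal T ∧
    ∀ g : G, ∃ U : Set G, U.Finite ∧ g ∈ U ∧ D.StatesClosed T U

end GData

/-! ### The semidirect product -/

/-- Right translation by `g` on the set `K \ G` of cosets `K x`: it sends `K x` to `K (x g)`. -/
def cosetTranslate {G : Type*} [Group G] (K : Subgroup G) (g : G) :
    Quotient (QuotientGroup.rightRel K) → Quotient (QuotientGroup.rightRel K) :=
  Quotient.map (fun x => x * g) (fun x y h => by
    have h' := QuotientGroup.rightRel_apply.1 h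
    exact QuotientGroup.rightRel_apply.2 (by simpa [mul_assoc] using h'))

/-- The right translation action of `G` on the set `K \ G` of cosets `K x`, as a homomorphism to
the permutations: `g` sends `K x` to `K (x g⁻¹)`. -/
def cosetPerm {G : Type*} [Group G] (K : Subgroup G) :
    G →* Equiv.Perm (Quotient (QuotientGroup.rightRel K)) where
  toFun g :=
    { toFun := cosetTranslate K g⁻¹
      invFun := cosetTranslate K g
      left_inv := by
        rintro ⟨x⟩
        exact congrArg (Quotient.mk _) (inv_mul_cancel_right x g)
      right_inv := by
        rintro ⟨x⟩
        exact congrArg (Quotient.mk _) (mul_inv_cancel_right x g) }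
  map_one' := by
    ext ⟨x⟩
    exact congrArg (Quotient.mk _) (show x * (1 : G)⁻¹ = x by simp)
  map_mul' a b := by
    ext ⟨x⟩
    exact congrArg (Quotient.mk _) (show x * (a * b)⁻¹ = x * b⁻¹ * a⁻¹ by simp [mul_assoc])

namespace GData

variable {G : Type*} [Group G] {s : ℕ} (D : GData G s)

/-- The product `(H_{ω 1} \ G) × ⋯ × (H_{ω s} \ G)`. -/
abbrev CosetProd : Type _ := ∀ i : Fin s, Quotient (QuotientGroup.rightRel (D.parabolic i))

/-- `G ^ s` acting componentwise on the product of the coset spaces. -/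
def cosetProdPerm : (Fin s → G) →* Equiv.Perm D.CosetProd where
  toFun g := Equiv.piCongrRight fun i => cosetPerm (D.parabolic i) (g i)
  map_one' := by ext x i; simp
  map_mul' a b := by ext x i; simp

/-- `G ^ s` acting on the finitely supported functions from the product of the coset spaces to `A`
by permuting the coordinates. -/
noncomputable def baseAction (A : Type*) [AddCommGroup A] :
    (Fin s → G) →* MulAut (Multiplicative (D.CosetProd →₀ A)) where
  toFun g := AddEquiv.toMultiplicative (Finsupp.domCongr (D.cosetProdPerm g))
  map_one' := by
    ext x : 1
    apply Multiplicative.toAdd.injective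
    ext c
    simp [Equiv.Perm.one_def]
  map_mul' a b := by
    ext x : 1
    apply Multiplicative.toAdd.injective
    ext c
    simp [Equiv.Perm.mul_def]

/-- The group `A ^ ((H_{ω 1} \ G) × ⋯ × (H_{ω s} \ G)) ⋊ G ^ s`, with the direct sum of copies of
`A` as its base group. -/
abbrev CosetWreath (A : Type*) [AddCommGroup A] : Type _ :=
  Multiplicative (D.CosetProd →₀ A) ⋊[D.baseAction A] (Fin s → G)

end GData

section

open Subgroup

namespace GData

variable {G : Type*} [Group G] {s : ℕ} (D : GData G s)

/-! Embed `A` in `ℤ ^ q × M` with `M` finite and the map to `M` split. The semidirect product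
receives `s + q` virtual endomorphisms. One applies `f i` on coordinate `i` and moves the base group
along the points with all representatives in `H i`, killing the other points (`pushEnd`). The next
`s - 1` kill the base group and permute the `f i` cyclically over the coordinates (`shiftEnd`). Each
of these `s` domains also requires the `M`-part of a sum of base values to vanish. The last `q` are
defined everywhere and record a lattice coordinate of the total sum as an exponent of an element `c`
of infinite order (`sumEnd`).

Simplicity (`isSimple_append`): an invariant normal subgroup projects trivially to every coordinate
of `G ^ s`, since every `f k` acts on every coordinate. Iterated pushing leaves only the value at
the base point (`push_iterate_eventually`); `sumEnd` kills its lattice part, the domain condition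
its `M`-part. Conjugation carries this to all points.

Finite-state (`isFiniteState_append`): support inside a finite state-closed set of cosets and a
bounded `ℓ¹`-height define finite sets closed under states, because the transversals use only
torsion elements, of height zero. -/

theorem invariant_iff {i : Fin s} {K : Subgroup G} :
    D.Invariant i K ↔ ∀ x ∈ K, ∃ h : x ∈ D.H i, D.f i ⟨x, h⟩ ∈ K := by
  constructor
  · rintro ⟨h1, h2⟩ x hx
    exact ⟨h1 hx, h2 ⟨⟨x, h1 hx⟩, hx, rfl⟩⟩
  · intro h
    refine ⟨fun x hx => (h x hx).1, ?_⟩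
    rintro _ ⟨⟨x, hx'⟩, hx, rfl⟩
    exact (h x hx).2

theorem eq_bot_of_invariant {D : GData G s} (hD : D.IsSimple) {K : Subgroup G} (hK : K.Normal)
    (h : ∀ i, D.Invariant i K) : K = ⊥ := by
  rw [eq_bot_iff, ← hD]
  exact le_sSup ⟨hK, h⟩

theorem isSimple_of_forall
    (h : ∀ K : Subgroup G, K.Normal → (∀ i, D.Invariant i K) → ∀ x ∈ K, x = 1) : D.IsSimple :=
  eq_bot_iff.2 (sSup_le fun K hK => fun x hx => mem_bot.2 (h K hK.1 hK.2 x hx))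

theorem exists_isTransversal : ∃ T : Fin s → Set G, D.IsTransversal T := by
  choose T hT using fun i => exists_isComplement_right (D.H i) 1
  exact ⟨T, hT⟩

variable {D} {T : Fin s → Set G}

theorem IsTransversal.finite (hT : D.IsTransversal T) (i : Fin s) : Finite (T i) := by
  have := D.finiteIndex i
  exact (hT i).1.finite_right

/-- The transversal property at `g⁻¹`, inverted: in this form the group acts on the letters from the
left. -/
theorem IsTransversal.exists_unique (hT : D.IsTransversal T) (i : Fin s) (g : G) :
    ∃! t : T i, (t : G) * g ∈ D.H i := by
  have := isComplement_iff_existsUnique_mul_inv_mem.1 (hT i).1 g⁻¹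
  have e : ∀ t : T i, g⁻¹ * (t : G)⁻¹ ∈ (D.H i : Set G) ↔ (t : G) * g ∈ D.H i := fun t => by
    rw [← mul_inv_rev, SetLike.mem_coe, inv_mem_iff]
  simpa only [e] using this

/-! ### The tree action of a group with data -/

/-- The letter to which `g` sends the coset representative `t`. -/
noncomputable def letter (hT : D.IsTransversal T) (g : G) (y : Σ i, T i) : Σ i, T i :=
  ⟨y.1, (hT.exists_unique y.1 (g * (y.2 : G)⁻¹)).choose⟩

theorem letter_mem (hT : D.IsTransversal T) (g : G) (y : Σ i, T i) :
    ((letter hT g y).2 : G) * g * (y.2 : G)⁻¹ ∈ D.H y.1 := by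
  rw [mul_assoc]
  exact (hT.exists_unique y.1 (g * (y.2 : G)⁻¹)).choose_spec.1

theorem letter_eq (hT : D.IsTransversal T) {g : G} {i : Fin s} {t t' : T i}
    (h : (t' : G) * g * (t : G)⁻¹ ∈ D.H i) : letter hT g ⟨i, t⟩ = ⟨i, t'⟩ := by
  rw [mul_assoc] at h
  have := (hT.exists_unique i (g * (t : G)⁻¹)).choose_spec.2 t' h
  rw [this]
  rfl

/-- The state of `g` at a coset representative. -/
noncomputable def letterState (hT : D.IsTransversal T) (g : G) (y : Σ i, T i) : G :=
  D.f y.1 ⟨_, letter_mem hT g y⟩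

theorem letterState_eq (hT : D.IsTransversal T) {g : G} {i : Fin s} {t t' : T i}
    (h : (t' : G) * g * (t : G)⁻¹ ∈ D.H i) :
    letterState hT g ⟨i, t⟩ = D.f i ⟨(t' : G) * g * (t : G)⁻¹, h⟩ := by
  have h2 := letter_eq hT h
  unfold letterState
  congr 2
  rw [h2]

theorem letter_one (hT : D.IsTransversal T) (y : Σ i, T i) : letter hT 1 y = y :=
  letter_eq hT (t' := y.2) (by simp)

theorem letterState_one (hT : D.IsTransversal T) (y : Σ i, T i) : letterState hT 1 y = 1 := by
  obtain ⟨i, t⟩ := y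
  rw [letterState_eq hT (t' := t) (by simp)]
  convert map_one (D.f i)
  simp

/-- The two factors telescope; both the action law and the cocycle law for states rest on this. -/
theorem letter_mul_mem (hT : D.IsTransversal T) (g h : G) (y : Σ i, T i) :
    ((letter hT g (letter hT h y)).2 : G) * (g * h) * (y.2 : G)⁻¹ ∈ D.H y.1 := by
  have h1 := letter_mem hT g (letter hT h y)
  have h2 := letter_mem hT h y
  have := (D.H y.1).mul_mem h1 h2
  convert this using 1
  group

theorem letter_mul (hT : D.IsTransversal T) (g h : G) (y : Σ i, T i) :
    letter hT (g * h) y = letter hT g (letter hT h y) :=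
  letter_eq hT (letter_mul_mem hT g h y)

theorem letterState_mul (hT : D.IsTransversal T) (g h : G) (y : Σ i, T i) :
    letterState hT (g * h) y = letterState hT g (letter hT h y) * letterState hT h y := by
  rw [show letterState hT (g * h) y = _ from letterState_eq hT (letter_mul_mem hT g h y)]
  have : letterState hT g (letter hT h y) =
    D.f y.1 ⟨_, letter_mem hT g (letter hT h y)⟩ := rfl
  rw [this, letterState, ← map_mul]
  congr 1
  refine Subtype.ext ?_
  change _ = ((letter hT g (letter hT h y)).2 : G) * g * ((letter hT h y).2 : G)⁻¹ *
    (((letter hT h y).2 : G) * h * (y.2 : G)⁻¹)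
  group

end GData

/-! ### Groups of tree automorphisms given by automata -/

/-- A group acting on an alphabet together with a state for each group element and letter. -/
structure GroupAutomaton (G Y : Type*) [Group G] where
  act : G → Y → Y
  st : G → Y → G
  act_one : ∀ y, act 1 y = y
  act_mul : ∀ g h y, act (g * h) y = act g (act h y)
  st_one : ∀ y, st 1 y = 1
  st_mul : ∀ g h y, st (g * h) y = st g (act h y) * st h y

namespace GroupAutomaton

variable {G Y : Type*} [Group G] (M : GroupAutomaton G Y)

/-- The action on words. -/
def run : G → List Y → List Y
  | _, [] => []
  | g, y :: w => M.act g y :: run (M.st g y) w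

/-- The state at a word. -/
def stWord : G → List Y → G
  | g, [] => g
  | g, y :: w => stWord (M.st g y) w

theorem run_one (w : List Y) : M.run 1 w = w := by
  induction w with
  | nil => rfl
  | cons y w ih => rw [run, M.act_one, M.st_one, ih]

theorem run_mul (g h : G) (w : List Y) : M.run (g * h) w = M.run g (M.run h w) := by
  induction w generalizing g h with
  | nil => rfl
  | cons y w ih => simp only [run, M.act_mul, M.st_mul, ih]

theorem run_length (g : G) (w : List Y) : (M.run g w).length = w.length := by
  induction w generalizing g with
  | nil => rfl
  | cons y w ih => simp only [run, List.length_cons, ih]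

theorem run_append (g : G) (u w : List Y) :
    M.run g (u ++ w) = M.run g u ++ M.run (M.stWord g u) w := by
  induction u generalizing g with
  | nil => rfl
  | cons y u ih => simp only [run, List.cons_append, stWord, ih]

/-- The representation by tree automorphisms. -/
def toTreeAut : G →* TreeAut Y where
  toFun g := ⟨{ toFun := M.run g
                invFun := M.run g⁻¹
                left_inv := fun w => by rw [← run_mul, inv_mul_cancel, run_one]
                right_inv := fun w => by rw [← run_mul, mul_inv_cancel, run_one] },
    M.run_length g, by
      rintro u _ ⟨w, rfl⟩
      exact ⟨_, (M.run_append g u w).symm⟩⟩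
  map_one' := by
    ext w : 2
    exact M.run_one w
  map_mul' g h := by
    ext w : 2
    exact M.run_mul g h w

theorem toTreeAut_apply (g : G) (w : List Y) : (M.toTreeAut g).1 w = M.run g w := rfl

theorem state_toTreeAut (g : G) (u : List Y) :
    TreeAut.state (M.toTreeAut g) u = M.toTreeAut (M.stWord g u) := by
  ext w : 2
  change (M.run g (u ++ w)).drop u.length = M.run (M.stWord g u) w
  rw [run_append, ← M.run_length g u, List.drop_left]

theorem isSelfSimilar_range : TreeAut.IsSelfSimilar M.toTreeAut.range := by
  rintro _ ⟨g, rfl⟩ _ ⟨u, rfl⟩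
  exact ⟨_, (M.state_toTreeAut g u).symm⟩

theorem isFiniteState_toTreeAut {U : Set G} (hU : U.Finite) (h : ∀ g ∈ U, ∀ y, M.st g y ∈ U)
    {g : G} (hg : g ∈ U) : TreeAut.IsFiniteState (M.toTreeAut g) := by
  refine (hU.image M.toTreeAut).subset ?_
  rintro _ ⟨u, rfl⟩
  rw [state_toTreeAut]
  refine Set.mem_image_of_mem _ ?_
  induction u generalizing g with
  | nil => exact hg
  | cons y u ih => exact ih (h g hg y)

theorem act_eq_of_mem_ker {g : G} (hg : g ∈ M.toTreeAut.ker) (y : Y) : M.act g y = y := by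
  have : (M.toTreeAut g).1 [y] = [y] := by rw [MonoidHom.mem_ker.1 hg]; rfl
  simpa [toTreeAut_apply, run] using this

/-- The kernel is a normal subgroup closed under states, so for an automaton coming from data it
lies in the core. -/
theorem st_mem_ker {g : G} (hg : g ∈ M.toTreeAut.ker) (y : Y) :
    M.st g y ∈ M.toTreeAut.ker := by
  rw [MonoidHom.mem_ker]
  ext w : 2
  have : (M.toTreeAut g).1 (y :: w) = y :: w := by rw [MonoidHom.mem_ker.1 hg]; rfl
  simp only [toTreeAut_apply, run, List.cons.injEq] at this
  exact this.2

/-- Renaming the letters of the alphabet. -/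
def congr {Z : Type*} (e : Y ≃ Z) : GroupAutomaton G Z where
  act g z := e (M.act g (e.symm z))
  st g z := M.st g (e.symm z)
  act_one z := by simp [M.act_one]
  act_mul g h z := by simp [M.act_mul]
  st_one z := by simp [M.st_one]
  st_mul g h z := by simp [M.st_mul]

end GroupAutomaton

/-! ### Faithful self-similar representations from simple data -/

namespace GData

variable {G : Type*} [Group G] {s : ℕ} {D : GData G s} {T : Fin s → Set G}

/-- The automaton of a group with data and transversals. -/
noncomputable def automaton (hT : D.IsTransversal T) : GroupAutomaton G (Σ i, T i) where
  act := letter hT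
  st := letterState hT
  act_one := letter_one hT
  act_mul := letter_mul hT
  st_one := letterState_one hT
  st_mul := letterState_mul hT

theorem exists_treeAut_of_isTransversal [Nontrivial G] (hD : D.IsSimple)
    (hT : D.IsTransversal T) :
    ∃ n : ℕ, 2 ≤ n ∧ ∃ φ : G →* TreeAut (Fin n),
      Function.Injective φ ∧ TreeAut.IsSelfSimilar φ.range ∧
      ∀ U : Set G, U.Finite → D.StatesClosed T U → ∀ g ∈ U, TreeAut.IsFiniteState (φ g) := by
  classical
  have hfin := hT.finite
  have hY : Nontrivial (Σ i, T i) := by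
    -- With at most one letter every `H i` is all of `G`, so `G` itself would be invariant.
    by_contra h
    rw [not_nontrivial_iff_subsingleton] at h
    refine top_ne_bot (eq_bot_of_invariant hD (K := (⊤ : Subgroup G)) inferInstance
      fun i => D.invariant_iff.2 fun x _ => ⟨?_, mem_top _⟩)
    have h1 := letter_mem hT x ⟨i, 1, (hT i).2⟩
    rwa [h.elim (letter hT x ⟨i, 1, (hT i).2⟩) ⟨i, 1, (hT i).2⟩, one_mul, inv_one, mul_one] at h1
  obtain ⟨n, ⟨e⟩⟩ := Finite.exists_equiv_fin (Σ i, T i)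
  have hn : 2 ≤ n := by
    have := Finite.one_lt_card (α := Σ i, T i)
    rwa [Nat.card_congr e, Nat.card_fin] at this
  set M := (automaton hT).congr e
  refine ⟨n, hn, M.toTreeAut, ?_, M.isSelfSimilar_range, ?_⟩
  · rw [← MonoidHom.ker_eq_bot_iff]
    refine eq_bot_of_invariant hD inferInstance fun i => D.invariant_iff.2 fun x hx => ?_
    -- At the letter `1 ∈ T i`, being fixed means lying in `H i`, and the state is `f i x`.
    have h1 : letter hT x ⟨i, 1, (hT i).2⟩ = ⟨i, 1, (hT i).2⟩ := by
      have := M.act_eq_of_mem_ker hx (e ⟨i, 1, (hT i).2⟩)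
      simpa [M, GroupAutomaton.congr, automaton] using this
    have h2 := letter_mem hT x ⟨i, 1, (hT i).2⟩
    rw [h1] at h2
    have h4 : M.st x (e ⟨i, 1, (hT i).2⟩) = D.f i ⟨_, h2⟩ := by
      rw [← letterState_eq hT (t := ⟨1, (hT i).2⟩) h2]
      exact congrArg (letterState hT x) (e.symm_apply_apply _)
    have h5 := M.st_mem_ker hx (e ⟨i, 1, (hT i).2⟩)
    rw [h4] at h5
    simp only [one_mul, inv_one, mul_one] at h2 h5
    exact ⟨h2, h5⟩
  · intro U hU hcl g hg
    refine M.isFiniteState_toTreeAut hU (fun x hx z => ?_) hg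
    exact hcl x hx _ _ (letter hT x (e.symm z)).2.2 _ (e.symm z).2.2 (letter_mem hT x (e.symm z))

theorem IsSimple.exists_treeAut [Nontrivial G] (hD : D.IsSimple) :
    ∃ n : ℕ, 2 ≤ n ∧ ∃ φ : G →* TreeAut (Fin n),
      Function.Injective φ ∧ TreeAut.IsSelfSimilar φ.range ∧
      (D.IsFiniteState → ∀ g, TreeAut.IsFiniteState (φ g)) := by
  -- The transversals must be those witnessing finiteness, if there are any; otherwise any choice
  -- serves.
  by_cases h : D.IsFiniteState
  · obtain ⟨T, hT, hU⟩ := h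
    obtain ⟨n, hn, φ, h1, h2, h3⟩ := exists_treeAut_of_isTransversal hD hT
    refine ⟨n, hn, φ, h1, h2, fun _ g => ?_⟩
    obtain ⟨U, hf, hg, hc⟩ := hU g
    exact h3 U hf hc g hg
  · obtain ⟨T, hT⟩ := D.exists_isTransversal
    obtain ⟨n, hn, φ, h1, h2, -⟩ := exists_treeAut_of_isTransversal hD hT
    exact ⟨n, hn, φ, h1, h2, fun h' => absurd h' h⟩

end GData

namespace GData

variable {G : Type*} [Group G] {s : ℕ} (D : GData G s)

/-! ### The coset spaces -/

/-- The elements of `H i` that `f i` sends into the supremum form a subgroup containing every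
invariant `K`, hence containing the supremum. -/
theorem invariant_parabolic (i : Fin s) : D.Invariant i (D.parabolic i) := by
  have h : D.parabolic i ≤ ((D.parabolic i).comap (D.f i)).map (D.H i).subtype := by
    refine sSup_le fun K hK x hx => ?_
    obtain ⟨h1, h2⟩ := D.invariant_iff.1 hK x hx
    exact ⟨⟨x, h1⟩, (le_sSup hK : K ≤ D.parabolic i) h2, rfl⟩
  refine D.invariant_iff.2 fun x hx => ?_
  obtain ⟨⟨y, hy⟩, hy', rfl⟩ := h hx
  exact ⟨hy, hy'⟩

/-- The subgroup of the elements to which `f i` can be applied `n` times. -/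
def iterDomain (i : Fin s) : ℕ → Subgroup G
  | 0 => ⊤
  | n + 1 => ((iterDomain i n).comap (D.f i)).map (D.H i).subtype

theorem mem_iterDomain_succ {i : Fin s} {n : ℕ} {x : G} :
    x ∈ D.iterDomain i (n + 1) ↔ ∃ h : x ∈ D.H i, D.f i ⟨x, h⟩ ∈ D.iterDomain i n := by
  constructor
  · rintro ⟨⟨y, hy⟩, hy', rfl⟩
    exact ⟨hy, hy'⟩
  · rintro ⟨h1, h2⟩
    exact ⟨⟨x, h1⟩, h2, rfl⟩

theorem iInf_iterDomain_le (i : Fin s) : ⨅ n, D.iterDomain i n ≤ D.parabolic i := by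
  refine le_sSup (D.invariant_iff.2 fun x hx => ?_)
  simp only [mem_iInf] at hx
  obtain ⟨h, -⟩ := D.mem_iterDomain_succ.1 (hx 1)
  refine ⟨h, mem_iInf.2 fun n => ?_⟩
  exact (D.mem_iterDomain_succ.1 (hx (n + 1))).2

/-- The point of the product of the coset spaces with the given representatives. -/
def pt (u : Fin s → G) : D.CosetProd := fun i => Quotient.mk _ (u i)

theorem exists_pt (x : D.CosetProd) : ∃ u, D.pt u = x := by
  choose u hu using fun i => Quotient.exists_rep (x i)
  exact ⟨u, funext hu⟩

variable {D}

theorem mk_eq_mk {i : Fin s} {u v : G} :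
    (Quotient.mk (QuotientGroup.rightRel (D.parabolic i)) u = Quotient.mk _ v) ↔
      v * u⁻¹ ∈ D.parabolic i :=
  Quotient.eq.trans QuotientGroup.rightRel_apply

theorem pt_eq_pt {u v : Fin s → G} :
    D.pt u = D.pt v ↔ ∀ i, v i * (u i)⁻¹ ∈ D.parabolic i :=
  funext_iff.trans (forall_congr' fun _ => mk_eq_mk)

theorem cosetProdPerm_pt (g u : Fin s → G) : D.cosetProdPerm g (D.pt u) = D.pt (u * g⁻¹) := rfl

variable (D)

/-- The points all of whose coordinates have representatives in `H i`. -/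
def block : Set D.CosetProd := {x | ∃ u : Fin s → G, (∀ i, u i ∈ D.H i) ∧ D.pt u = x}

variable {D} in
theorem pt_mem_block {u : Fin s → G} : D.pt u ∈ D.block ↔ ∀ i, u i ∈ D.H i := by
  refine ⟨?_, fun h => ⟨u, h, rfl⟩⟩
  rintro ⟨v, hv, h⟩ i
  have := (D.invariant_parabolic i).1 (pt_eq_pt.1 h i)
  simpa using (D.H i).mul_mem this (hv i)

open Classical in
/-- The map induced by the `f i` on the block. -/
noncomputable def blockMap (x : D.CosetProd) : D.CosetProd :=
  if h : x ∈ D.block then D.pt fun i => D.f i ⟨h.choose i, h.choose_spec.1 i⟩ else x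

variable {D} in
-- Independence of the chosen representatives: `f i` maps the parabolic subgroup into itself.
theorem blockMap_pt {u : Fin s → G} (hu : ∀ i, u i ∈ D.H i) :
    D.blockMap (D.pt u) = D.pt fun i => D.f i ⟨u i, hu i⟩ := by
  have h : D.pt u ∈ D.block := pt_mem_block.2 hu
  rw [blockMap, dif_pos h, pt_eq_pt]
  intro i
  have h1 := pt_eq_pt.1 h.choose_spec.2 i
  obtain ⟨h2, h3⟩ := D.invariant_iff.1 (D.invariant_parabolic i) _ h1
  rw [← map_inv, ← map_mul]
  exact h3

/-! ### Translation, pushing and sums on the base group -/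

section base

variable (A : Type*) [AddCommGroup A]

/-- The translation of the base group by an element of `G ^ s`. -/
noncomputable def translate (g : Fin s → G) : (D.CosetProd →₀ A) →+ (D.CosetProd →₀ A) :=
  (Finsupp.domCongr (D.cosetProdPerm g)).toAddMonoidHom

open Classical in
/-- The map induced by the `f i` on the base group; it kills the points outside of the block. -/
noncomputable def push : (D.CosetProd →₀ A) →+ (D.CosetProd →₀ A) :=
  Finsupp.liftAddHom fun x => if x ∈ D.block then Finsupp.singleAddHom (D.blockMap x) else 0

open Classical in
/-- The sum over the block. -/
noncomputable def blockSum : (D.CosetProd →₀ A) →+ A :=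
  Finsupp.liftAddHom fun x => if x ∈ D.block then AddMonoidHom.id A else 0

/-- The sum over all points. -/
noncomputable def totalSum : (D.CosetProd →₀ A) →+ A :=
  Finsupp.liftAddHom fun _ => AddMonoidHom.id A

variable {D A}

theorem translate_single (g : Fin s → G) (x : D.CosetProd) (a : A) :
    D.translate A g (Finsupp.single x a) = Finsupp.single (D.cosetProdPerm g x) a := by
  simp [translate]

theorem translate_apply (g : Fin s → G) (φ : D.CosetProd →₀ A) (x : D.CosetProd) :
    D.translate A g φ (D.cosetProdPerm g x) = φ x := by
  simp [translate]

theorem push_single_pt {u : Fin s → G} (hu : ∀ i, u i ∈ D.H i) (a : A) :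
    D.push A (Finsupp.single (D.pt u) a) =
      Finsupp.single (D.pt fun i => D.f i ⟨u i, hu i⟩) a := by
  simp [push, pt_mem_block.2 hu, blockMap_pt hu]

theorem push_single_one (a : A) :
    D.push A (Finsupp.single (D.pt 1) a) = Finsupp.single (D.pt 1) a := by
  refine (push_single_pt (u := 1) (fun i => one_mem _) a).trans ?_
  congr 2
  funext i
  exact map_one _

theorem push_single_of_notMem {x : D.CosetProd} (hx : x ∉ D.block) (a : A) :
    D.push A (Finsupp.single x a) = 0 := by
  simp [push, hx]

theorem blockSum_single_of_mem {x : D.CosetProd} (hx : x ∈ D.block) (a : A) :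
    D.blockSum A (Finsupp.single x a) = a := by
  simp [blockSum, hx]

theorem blockSum_single_of_notMem {x : D.CosetProd} (hx : x ∉ D.block) (a : A) :
    D.blockSum A (Finsupp.single x a) = 0 := by
  simp [blockSum, hx]

theorem totalSum_single (x : D.CosetProd) (a : A) :
    D.totalSum A (Finsupp.single x a) = a := by
  simp [totalSum]

theorem cosetProdPerm_mem_block {h : Fin s → G} (hh : ∀ i, h i ∈ D.H i) {x : D.CosetProd} :
    D.cosetProdPerm h x ∈ D.block ↔ x ∈ D.block := by
  obtain ⟨u, rfl⟩ := D.exists_pt x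
  rw [cosetProdPerm_pt, pt_mem_block, pt_mem_block]
  refine forall_congr' fun i => ?_
  exact (D.H i).mul_mem_cancel_right ((D.H i).inv_mem (hh i))

/-- This equivariance makes `push` together with the `f i` a homomorphism. Translation by elements
of the `H i` preserves the block and its complement. -/
theorem push_translate {h : Fin s → G} (hh : ∀ i, h i ∈ D.H i) (φ : D.CosetProd →₀ A) :
    D.push A (D.translate A h φ) =
      D.translate A (fun i => D.f i ⟨h i, hh i⟩) (D.push A φ) := by
  suffices H : (D.push A).comp (D.translate A h) =
      (D.translate A (fun i => D.f i ⟨h i, hh i⟩)).comp (D.push A) from DFunLike.congr_fun H φ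
  refine Finsupp.addHom_ext fun x a => ?_
  simp only [AddMonoidHom.comp_apply, translate_single]
  obtain ⟨u, rfl⟩ := D.exists_pt x
  by_cases hu : ∀ i, u i ∈ D.H i
  · have hu' : ∀ i, (u * h⁻¹) i ∈ D.H i := fun i => (D.H i).mul_mem (hu i) ((D.H i).inv_mem (hh i))
    rw [cosetProdPerm_pt, push_single_pt hu', push_single_pt hu, translate_single,
      cosetProdPerm_pt]
    congr 2
    funext i
    simp only [Pi.mul_apply, Pi.inv_apply]
    rw [← map_inv, ← map_mul]
    rfl
  · have h1 : D.pt u ∉ D.block := fun h => hu (pt_mem_block.1 h)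
    rw [push_single_of_notMem h1, push_single_of_notMem, map_zero]
    rwa [cosetProdPerm_mem_block hh]

theorem blockSum_translate {h : Fin s → G} (hh : ∀ i, h i ∈ D.H i) (φ : D.CosetProd →₀ A) :
    D.blockSum A (D.translate A h φ) = D.blockSum A φ := by
  suffices H : (D.blockSum A).comp (D.translate A h) = D.blockSum A from DFunLike.congr_fun H φ
  refine Finsupp.addHom_ext fun x a => ?_
  simp only [AddMonoidHom.comp_apply, translate_single]
  by_cases hx : x ∈ D.block
  · rw [blockSum_single_of_mem hx, blockSum_single_of_mem ((cosetProdPerm_mem_block hh).2 hx)]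
  · rw [blockSum_single_of_notMem hx, blockSum_single_of_notMem]
    rwa [cosetProdPerm_mem_block hh]

theorem totalSum_translate (h : Fin s → G) (φ : D.CosetProd →₀ A) :
    D.totalSum A (D.translate A h φ) = D.totalSum A φ := by
  suffices H : (D.totalSum A).comp (D.translate A h) = D.totalSum A from DFunLike.congr_fun H φ
  refine Finsupp.addHom_ext fun x a => ?_
  simp only [AddMonoidHom.comp_apply, translate_single, totalSum_single]

theorem push_iterate_eq_zero (a : A) (n : ℕ) (u : Fin s → G) {i : Fin s}
    (hi : u i ∉ D.iterDomain i n) : (D.push A)^[n] (Finsupp.single (D.pt u) a) = 0 := by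
  induction n generalizing u with
  | zero => exact absurd (mem_top _) hi
  | succ n ih =>
    rw [Function.iterate_succ_apply]
    by_cases hu : ∀ i, u i ∈ D.H i
    · rw [push_single_pt hu]
      exact ih _ fun h => hi (D.mem_iterDomain_succ.2 ⟨hu i, h⟩)
    · rw [push_single_of_notMem (fun h => hu (pt_mem_block.1 h)), iterate_map_zero]

/-- The iterates of the induced map eventually retain only the value at the base point. -/
theorem push_iterate_eventually (φ : D.CosetProd →₀ A) :
    ∃ N, ∀ n ≥ N, (D.push A)^[n] φ = Finsupp.single (D.pt 1) (φ (D.pt 1)) := by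
  induction φ using Finsupp.induction_linear with
  | zero => exact ⟨0, fun n _ => by simp⟩
  | add φ ψ hφ hψ =>
    obtain ⟨N, hN⟩ := hφ
    obtain ⟨N', hN'⟩ := hψ
    refine ⟨max N N', fun n hn => ?_⟩
    rw [iterate_map_add, hN n (le_of_max_le_left hn), hN' n (le_of_max_le_right hn),
      Finsupp.add_apply, Finsupp.single_add]
  | single x a =>
    obtain ⟨u, rfl⟩ := D.exists_pt x
    by_cases hu : D.pt u = D.pt 1
    · rw [hu]
      refine ⟨0, fun n _ => ?_⟩
      rw [Finsupp.single_eq_same]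
      exact Function.iterate_fixed (push_single_one a) n
    -- Away from the base point some coordinate admits only finitely many applications of `f i`,
    -- after which the point is killed.
    · have h1 : ∃ i, u i ∉ D.parabolic i := by
        by_contra! h
        exact hu (pt_eq_pt.2 fun i => by simpa using (D.parabolic i).inv_mem (h i))
      obtain ⟨i, hi⟩ := h1
      have h2 : ∃ N, u i ∉ D.iterDomain i N := by
        by_contra! h
        exact hi (D.iInf_iterDomain_le i (mem_iInf.2 h))
      obtain ⟨N, hN⟩ := h2
      refine ⟨N, fun n hn => ?_⟩
      obtain ⟨k, rfl⟩ := Nat.exists_eq_add_of_le' hn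
      rw [Function.iterate_add_apply, push_iterate_eq_zero a N u hN, iterate_map_zero,
        Finsupp.single_eq_of_ne (Ne.symm hu), Finsupp.single_zero]

end base

end GData

/-! ### Splittings of abelian groups and heights -/

/-- Homomorphisms which exhibit `A` as embedded into `ℤ ^ q × M`, the map to `M` being split. -/
structure LatticeSplitting (A M : Type*) [AddCommGroup A] [AddCommGroup M] (q : ℕ) where
  χ : Fin q → A →+ ℤ
  ψ : A →+ M
  σ : M →+ A
  ψ_σ : ∀ b, ψ (σ b) = b
  eq_zero : ∀ a, (∀ k, χ k a = 0) → ψ a = 0 → a = 0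

namespace LatticeSplitting

section

variable {A M : Type*} [AddCommGroup A] [AddCommGroup M] {q : ℕ} (S : LatticeSplitting A M q)

/-- The height of an element of `A`: the `ℓ¹`-norm of its lattice part. -/
def height (a : A) : ℕ := ∑ k, (S.χ k a).natAbs

theorem height_zero : S.height 0 = 0 := by simp [height]

theorem height_add_le (a b : A) : S.height (a + b) ≤ S.height a + S.height b := by
  unfold height
  rw [← Finset.sum_add_distrib]
  refine Finset.sum_le_sum fun k _ => ?_
  rw [map_add]
  exact Int.natAbs_add_le _ _

theorem height_neg (a : A) : S.height (-a) = S.height a := by simp [height]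

theorem natAbs_χ_le (k : Fin q) (a : A) : (S.χ k a).natAbs ≤ S.height a :=
  Finset.single_le_sum (f := fun k => (S.χ k a).natAbs) (fun _ _ => Nat.zero_le _)
    (Finset.mem_univ k)

/-- `σ b` has finite order, and `ℤ` has no torsion. -/
theorem height_σ [Finite M] (b : M) : S.height (S.σ b) = 0 := by
  refine Finset.sum_eq_zero fun k _ => ?_
  have h : Nat.card M • S.χ k (S.σ b) = 0 := by
    rw [← map_nsmul, ← map_nsmul, card_nsmul_eq_zero', map_zero, map_zero]
  rw [Int.natAbs_eq_zero]
  exact (smul_eq_zero.1 h).resolve_left Nat.card_pos.ne'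

theorem finite_height_le [Finite M] (N : ℕ) : {a : A | S.height a ≤ N}.Finite := by
  have hf : (Set.pi Set.univ (fun _ : Fin q => Set.Icc (-(N : ℤ)) N) ×ˢ
      (Set.univ : Set M)).Finite :=
    (Set.Finite.pi fun _ => Set.finite_Icc _ _).prod Set.finite_univ
  refine Set.Finite.of_injOn (f := fun a => (fun k => S.χ k a, S.ψ a)) ?_ ?_ hf
  · intro a ha
    refine ⟨fun k _ => ?_, trivial⟩
    have h1 : (S.χ k a).natAbs ≤ N := (S.natAbs_χ_le k a).trans ha
    simp only [Set.mem_Icc]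
    omega
  · intro a _ b _ h
    obtain ⟨h1, h2⟩ := Prod.ext_iff.1 h
    refine sub_eq_zero.1 (S.eq_zero _ (fun k => ?_) ?_)
    · rw [map_sub, sub_eq_zero]
      exact congrFun h1 k
    · rw [map_sub, sub_eq_zero]
      exact h2

/-! ### Total height of finitely supported functions -/

variable {X : Type*}

/-- The sum of the heights of the values. -/
def totalHeight (φ : X →₀ A) : ℕ := φ.sum fun _ a => S.height a

theorem totalHeight_zero : S.totalHeight (0 : X →₀ A) = 0 := Finsupp.sum_zero_index

theorem totalHeight_single (x : X) (a : A) : S.totalHeight (Finsupp.single x a) = S.height a :=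
  Finsupp.sum_single_index S.height_zero

theorem totalHeight_add_le (φ η : X →₀ A) :
    S.totalHeight (φ + η) ≤ S.totalHeight φ + S.totalHeight η := by
  classical
  unfold totalHeight
  have h0 : ∀ i ∈ φ.support ∪ η.support, S.height 0 = 0 := fun _ _ => S.height_zero
  rw [Finsupp.sum_of_support_subset _ Finsupp.support_add _ h0,
    Finsupp.sum_of_support_subset φ Finset.subset_union_left _ h0,
    Finsupp.sum_of_support_subset η Finset.subset_union_right _ h0, ← Finset.sum_add_distrib]
  exact Finset.sum_le_sum fun x _ => S.height_add_le _ _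

theorem totalHeight_neg (φ : X →₀ A) : S.totalHeight (-φ) = S.totalHeight φ := by
  simp [totalHeight, Finsupp.sum, height_neg]

theorem totalHeight_map_le (Q : (X →₀ A) →+ (X →₀ A))
    (hQ : ∀ x a, S.totalHeight (Q (Finsupp.single x a)) ≤ S.height a) (φ : X →₀ A) :
    S.totalHeight (Q φ) ≤ S.totalHeight φ := by
  conv_lhs => rw [← Finsupp.sum_single φ, Finsupp.sum, map_sum]
  refine (Finset.le_sum_of_subadditive S.totalHeight S.totalHeight_zero.le S.totalHeight_add_le
    _ _).trans ?_
  exact Finset.sum_le_sum fun x _ => hQ _ _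

theorem height_le_totalHeight (φ : X →₀ A) (x : X) : S.height (φ x) ≤ S.totalHeight φ := by
  by_cases hx : φ x = 0
  · rw [hx, height_zero]
    exact Nat.zero_le _
  · exact Finset.single_le_sum (f := fun x => S.height (φ x)) (fun _ _ => Nat.zero_le _)
      (Finsupp.mem_support_iff.2 hx)

theorem finite_supported_totalHeight_le [Finite M] {P : Set X} (hP : P.Finite) (N : ℕ) :
    {φ : X →₀ A | φ ∈ Finsupp.supported A ℤ P ∧ S.totalHeight φ ≤ N}.Finite := by
  classical
  refine (Finset.finite_toSet
    (hP.toFinset.finsupp fun _ => (S.finite_height_le N).toFinset)).subset ?_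
  rintro φ ⟨h1, h2⟩
  rw [Finset.mem_coe, Finset.mem_finsupp_iff]
  refine ⟨fun x hx => hP.mem_toFinset.2 ((Finsupp.mem_supported _ _).1 h1 hx), fun x _ => ?_⟩
  exact (Set.Finite.mem_toFinset _).2 ((S.height_le_totalHeight φ x).trans h2)

end

/-- The splitting of a finite group. -/
def ofFinite (B : Type*) [AddCommGroup B] : LatticeSplitting B B 0 where
  χ := Fin.elim0
  ψ := AddMonoidHom.id B
  σ := AddMonoidHom.id B
  ψ_σ _ := rfl
  eq_zero _ _ h := h

/-- The splitting of `ℤ`. -/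
def int : LatticeSplitting ℤ Unit 1 where
  χ _ := AddMonoidHom.id ℤ
  ψ := 0
  σ := 0
  ψ_σ _ := rfl
  eq_zero _ h _ := h 0

open DirectSum in
theorem exists_of_fg (A : Type*) [AddCommGroup A] [AddGroup.FG A] :
    ∃ (q : ℕ) (M : Type) (_ : AddCommGroup M) (_ : Finite M), Nonempty (LatticeSplitting A M q) := by
  obtain ⟨q, ι, _, p, hp, e, ⟨f⟩⟩ := AddCommGroup.equiv_free_prod_directSum_zmod A
  classical
  have hfin : Finite (⨁ i : ι, ZMod (p i ^ e i)) := by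
    have : ∀ i, NeZero (p i ^ e i) := fun i => ⟨pow_ne_zero _ (hp i).ne_zero⟩
    exact Finite.of_equiv _ (DirectSum.addEquivProd fun i => ZMod (p i ^ e i)).symm.toEquiv
  refine ⟨q, ⨁ i : ι, ZMod (p i ^ e i), inferInstance, hfin, ⟨?_⟩⟩
  exact
  { χ := fun k => (Finsupp.applyAddHom k).comp ((AddMonoidHom.fst _ _).comp f.toAddMonoidHom)
    ψ := (AddMonoidHom.snd _ _).comp f.toAddMonoidHom
    σ := f.symm.toAddMonoidHom.comp (AddMonoidHom.inr _ _)
    ψ_σ := fun b => by simp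
    eq_zero := fun a h1 h2 => by
      have h3 : f a = 0 := Prod.ext (Finsupp.ext h1) h2
      simpa using h3 }

end LatticeSplitting

/-! ### Virtual endomorphisms -/

/-- A homomorphism to `G` from a subgroup of finite index. -/
structure VirtualEnd (G : Type*) [Group G] where
  dom : Subgroup G
  finiteIndex : dom.FiniteIndex
  hom : dom →* G

namespace VirtualEnd

variable {G : Type*} [Group G]

/-- `K` is contained in the domain and invariant. -/
def Preserves (v : VirtualEnd G) (K : Subgroup G) : Prop :=
  ∀ x ∈ K, ∃ h : x ∈ v.dom, v.hom ⟨x, h⟩ ∈ K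

/-- `T` is a transversal of the domain that contains the identity. -/
def IsTransversal (v : VirtualEnd G) (T : Set G) : Prop :=
  IsComplement (v.dom : Set G) T ∧ 1 ∈ T

/-- `U` is closed under the states for the transversal `T`. -/
def StatesClosed (v : VirtualEnd G) (T U : Set G) : Prop :=
  ∀ x ∈ U, ∀ t ∈ T, ∀ t' ∈ T, ∀ h : t * x * t'⁻¹ ∈ v.dom, v.hom ⟨t * x * t'⁻¹, h⟩ ∈ U

/-- The data given by a family of virtual endomorphisms. -/
def toData {r : ℕ} (e : Fin r → VirtualEnd G) : GData G r where
  H i := (e i).dom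
  finiteIndex i := (e i).finiteIndex
  f i := (e i).hom

theorem toData_append_invariant {r q : ℕ} {e : Fin r → VirtualEnd G} {e' : Fin q → VirtualEnd G}
    {K : Subgroup G} (h : ∀ i, (toData (Fin.append e e')).Invariant i K) :
    (∀ j, (e j).Preserves K) ∧ ∀ k, (e' k).Preserves K := by
  have h' : ∀ i, (Fin.append e e' i).Preserves K := fun i => (GData.invariant_iff _).1 (h i)
  exact ⟨fun j => by simpa using h' (Fin.castAdd q j), fun k => by simpa using h' (Fin.natAdd r k)⟩

theorem toData_append_isFiniteState {r q : ℕ} {e : Fin r → VirtualEnd G}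
    {e' : Fin q → VirtualEnd G} (T : Fin r → Set G) (T' : Fin q → Set G)
    (hT : ∀ j, (e j).IsTransversal (T j)) (hT' : ∀ k, (e' k).IsTransversal (T' k))
    (h : ∀ g : G, ∃ U : Set G, U.Finite ∧ g ∈ U ∧ (∀ j, (e j).StatesClosed (T j) U) ∧
      ∀ k, (e' k).StatesClosed (T' k) U) :
    (toData (Fin.append e e')).IsFiniteState := by
  refine ⟨Fin.append T T', fun i => ?_, fun g => ?_⟩
  · change (Fin.append e e' i).IsTransversal (Fin.append T T' i)
    refine Fin.addCases (fun j => ?_) (fun k => ?_) i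
    · simpa using hT j
    · simpa using hT' k
  · obtain ⟨U, h1, h2, h3, h4⟩ := h g
    refine ⟨U, h1, h2, fun x hx i => ?_⟩
    have : (Fin.append e e' i).StatesClosed (Fin.append T T' i) U := by
      refine Fin.addCases (fun j => ?_) (fun k => ?_) i
      · simpa using h3 j
      · simpa using h4 k
    exact this x hx

end VirtualEnd

namespace GData

variable {G : Type*} [Group G] {s : ℕ} {D : GData G s}

/-! ### Sets closed under states -/

/-- The state of `x⁻¹` for the pair `(t, t')` is the inverse of the state of `x` for `(t', t)`. -/
theorem StatesClosed.inv {T : Fin s → Set G} {U : Set G} (hU : D.StatesClosed T U) :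
    D.StatesClosed T U⁻¹ := by
  intro x hx i t ht t' ht' h
  have h1 : t' * x⁻¹ * t⁻¹ ∈ D.H i := by
    have := (D.H i).inv_mem h
    simpa [mul_assoc] using this
  have h2 := hU x⁻¹ hx i t' ht' t ht h1
  rw [Set.mem_inv, ← map_inv]
  convert h2 using 2
  ext
  simp [mul_assoc]

theorem StatesClosed.iUnion {ι : Sort*} {T : Fin s → Set G} {U : ι → Set G}
    (hU : ∀ j, D.StatesClosed T (U j)) : D.StatesClosed T (⋃ j, U j) := by
  intro x hx i t ht t' ht' h
  obtain ⟨j, hj⟩ := Set.mem_iUnion.1 hx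
  exact Set.mem_iUnion.2 ⟨j, hU j x hj i t ht t' ht' h⟩

theorem exists_finite_statesClosed {T : Fin s → Set G}
    (hT : ∀ g : G, ∃ U : Set G, U.Finite ∧ g ∈ U ∧ D.StatesClosed T U) {S : Set G}
    (hS : S.Finite) :
    ∃ U : Set G, U.Finite ∧ S ⊆ U ∧ (∀ x ∈ U, x⁻¹ ∈ U) ∧ D.StatesClosed T U := by
  choose V hV1 hV2 hV3 using hT
  have := hS.to_subtype
  refine ⟨⋃ g : S, ⋃ b : Bool, if b then V g else (V g)⁻¹, ?_, ?_, ?_, ?_⟩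
  · refine Set.finite_iUnion fun g => Set.finite_iUnion fun b => ?_
    cases b
    · exact (hV1 g).inv
    · exact hV1 g
  · intro g hg
    exact Set.mem_iUnion.2 ⟨⟨g, hg⟩, Set.mem_iUnion.2 ⟨true, hV2 g⟩⟩
  · intro x hx
    simp only [Set.mem_iUnion] at hx ⊢
    obtain ⟨g, b, hb⟩ := hx
    refine ⟨g, !b, ?_⟩
    cases b <;> simpa using hb
  · refine StatesClosed.iUnion fun g => StatesClosed.iUnion fun b => ?_
    cases b
    · exact (hV3 g).inv
    · exact hV3 g

/-! ### Virtual endomorphisms of the semidirect product -/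

section wreath

variable {A : Type*} [AddCommGroup A]

/-- The component of an element in the base group. -/
def base (x : D.CosetWreath A) : D.CosetProd →₀ A := Multiplicative.toAdd x.left

/-- The element with the given components. -/
def wreathMk (φ : D.CosetProd →₀ A) (g : Fin s → G) : D.CosetWreath A :=
  ⟨Multiplicative.ofAdd φ, g⟩

theorem base_wreathMk (φ : D.CosetProd →₀ A) (g : Fin s → G) : base (wreathMk φ g) = φ := rfl

theorem right_wreathMk (φ : D.CosetProd →₀ A) (g : Fin s → G) : (wreathMk φ g).right = g := rfl

theorem base_mul (x y : D.CosetWreath A) :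
    base (x * y) = base x + D.translate A x.right (base y) := rfl

theorem base_one : base (1 : D.CosetWreath A) = 0 := rfl

theorem base_inv (x : D.CosetWreath A) :
    base x⁻¹ = - D.translate A x.right⁻¹ (base x) :=
  map_neg (D.translate A x.right⁻¹) (base x)

theorem wreath_ext {x y : D.CosetWreath A} (h1 : base x = base y) (h2 : x.right = y.right) :
    x = y := SemidirectProduct.ext h1 h2

theorem translate_mul (g h : Fin s → G) (φ : D.CosetProd →₀ A) :
    D.translate A (g * h) φ = D.translate A g (D.translate A h φ) :=
  DFunLike.congr_fun (map_mul (D.baseAction A) g h) (Multiplicative.ofAdd φ)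

theorem base_mul_mul_inv (t x t' : D.CosetWreath A) :
    base (t * x * t'⁻¹) = base t + D.translate A t.right (base x) -
      D.translate A (t * x * t'⁻¹).right (base t') := by
  rw [base_mul, base_mul, base_inv, map_neg, ← translate_mul, ← sub_eq_add_neg]
  rfl

variable (D A) in
/-- The ingredients of a virtual endomorphism of the semidirect product: on the coordinate `i` of
`G ^ s` it is `f (shift i)`, on the base group it is `map`, and its domain is cut out by `sum`. -/
structure CosetEnd {M : Type*} [AddCommGroup M] (ψ : A →+ M) where
  shift : Fin s → Fin s
  sum : (D.CosetProd →₀ A) →+ M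
  map : (D.CosetProd →₀ A) →+ (D.CosetProd →₀ A)
  sum_single : ∀ a, sum (Finsupp.single (D.pt 1) a) = ψ a
  sum_translate : ∀ h : Fin s → G, (∀ i, h i ∈ D.H (shift i)) → ∀ φ,
    sum (D.translate A h φ) = sum φ
  map_translate : ∀ (h : Fin s → G) (hh : ∀ i, h i ∈ D.H (shift i)) (φ : D.CosetProd →₀ A),
    map (D.translate A h φ) = D.translate A (fun i => D.f (shift i) ⟨h i, hh i⟩) (map φ)
  map_eq : map = 0 ∨ (map = D.push A ∧ shift = id)

variable {M : Type*} [AddCommGroup M]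

variable (D) in
/-- The virtual endomorphism which pushes the block of the base group forward. -/
noncomputable def pushEnd (ψ : A →+ M) : D.CosetEnd A ψ where
  shift := id
  sum := ψ.comp (D.blockSum A)
  map := D.push A
  sum_single a := congrArg ψ (blockSum_single_of_mem (pt_mem_block.2 fun _ => one_mem _) a)
  sum_translate _ hh φ := congrArg ψ (blockSum_translate hh φ)
  map_translate _ hh φ := push_translate hh φ
  map_eq := Or.inr ⟨rfl, rfl⟩

variable (D) in
/-- The virtual endomorphism which kills the base group and shifts the maps `f i`. -/
noncomputable def shiftEnd (ψ : A →+ M) (shift : Fin s → Fin s) : D.CosetEnd A ψ where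
  shift := shift
  sum := ψ.comp (D.totalSum A)
  map := 0
  sum_single a := congrArg ψ (totalSum_single _ a)
  sum_translate _ _ φ := congrArg ψ (totalSum_translate _ φ)
  map_translate _ _ _ := (map_zero _).symm
  map_eq := Or.inl rfl

namespace CosetEnd

variable {ψ : A →+ M} (e : D.CosetEnd A ψ)

/-- The domain of the virtual endomorphism. -/
def dom : Subgroup (D.CosetWreath A) where
  carrier := {x | e.sum (base x) = 0 ∧ ∀ i, x.right i ∈ D.H (e.shift i)}
  one_mem' := ⟨map_zero _, fun _ => one_mem _⟩
  mul_mem' := by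
    rintro x y ⟨hx, hx'⟩ ⟨hy, hy'⟩
    refine ⟨?_, fun i => mul_mem (hx' i) (hy' i)⟩
    rw [base_mul, map_add, e.sum_translate _ hx', hx, hy, add_zero]
  inv_mem' := by
    rintro x ⟨hx, hx'⟩
    have h : ∀ i, x.right⁻¹ i ∈ D.H (e.shift i) := fun i => inv_mem (hx' i)
    refine ⟨?_, h⟩
    rw [base_inv, map_neg, e.sum_translate _ h, hx, neg_zero]

theorem mem_dom {x : D.CosetWreath A} :
    x ∈ e.dom ↔ e.sum (base x) = 0 ∧ ∀ i, x.right i ∈ D.H (e.shift i) := Iff.rfl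

/-- The transversal of the domain given by transversals of the `H i` and a section of `ψ`. -/
noncomputable def transversal (σ : M →+ A) (T : Fin s → Set G) : Set (D.CosetWreath A) :=
  Set.range fun p : M × (∀ i, T (e.shift i)) =>
    wreathMk (Finsupp.single (D.pt 1) (σ p.1)) fun i => (p.2 i : G)

theorem one_mem_transversal (σ : M →+ A) {T : Fin s → Set G} (hT : D.IsTransversal T) :
    1 ∈ e.transversal σ T :=
  ⟨(0, fun i => ⟨1, (hT (e.shift i)).2⟩), wreath_ext (by simp [base_wreathMk, base_one]) rfl⟩

/-- The coset of the `G ^ s` part determines the `t i`. Then `sum`, invariant under the remaining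
translation, determines the element of `M`, because `σ` splits `ψ`. -/
theorem isComplement_transversal {σ : M →+ A} (hσ : ∀ b, ψ (σ b) = b) {T : Fin s → Set G}
    (hT : D.IsTransversal T) :
    IsComplement (e.dom : Set (D.CosetWreath A)) (e.transversal σ T) := by
  rw [isComplement_iff_existsUnique_mul_inv_mem]
  intro x
  have hu := fun i => isComplement_iff_existsUnique_mul_inv_mem.1 (hT (e.shift i)).1 (x.right i)
  have key : ∀ p : M × (∀ i, T (e.shift i)),
      x * (wreathMk (Finsupp.single (D.pt 1) (σ p.1)) fun i => (p.2 i : G))⁻¹ ∈ e.dom ↔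
        (∀ i, x.right i * (p.2 i : G)⁻¹ ∈ D.H (e.shift i)) ∧ p.1 = e.sum (base x) := by
    intro p
    rw [mem_dom, and_comm]
    refine and_congr_right fun h => ?_
    rw [← one_mul x, base_mul_mul_inv, one_mul, map_sub, base_wreathMk, e.sum_translate _ h,
      e.sum_single, hσ, base_one, zero_add, sub_eq_zero, eq_comm]
    have : D.translate A 1 (base x) = base x := by
      refine DFunLike.congr_fun (map_one (D.baseAction A)) (Multiplicative.ofAdd (base x))
    rw [show (1 : D.CosetWreath A).right = 1 from rfl, this]
  choose t ht ht' using hu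
  refine ⟨⟨_, ⟨(e.sum (base x), t), rfl⟩⟩, (key _).2 ⟨ht, rfl⟩, ?_⟩
  rintro ⟨_, ⟨p, rfl⟩⟩ hp
  obtain ⟨h1, h2⟩ := (key p).1 hp
  have : p = (e.sum (base x), t) := Prod.ext h2 (funext fun i => ht' i _ (h1 i))
  subst this
  rfl

theorem index_dom {σ : M →+ A} (hσ : ∀ b, ψ (σ b) = b) :
    e.dom.index = Nat.card M * ∏ i, (D.H (e.shift i)).index := by
  obtain ⟨T, hT⟩ := D.exists_isTransversal
  rw [← (e.isComplement_transversal hσ hT).card_right]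
  have hinj : Function.Injective fun p : M × (∀ i, T (e.shift i)) =>
      (wreathMk (Finsupp.single (D.pt 1) (σ p.1)) fun i => (p.2 i : G) : D.CosetWreath A) := by
    intro p p' h
    refine Prod.ext ?_ (funext fun i => Subtype.ext ?_)
    · have h1 : σ p.1 = σ p'.1 := Finsupp.single_injective _ (congrArg base h)
      rw [← hσ p.1, h1, hσ]
    · exact congrFun (congrArg SemidirectProduct.right h) i
  rw [transversal, Nat.card_congr (Equiv.ofInjective _ hinj).symm, Nat.card_prod, Nat.card_pi]
  congr 1
  exact Finset.prod_congr rfl fun i _ => (hT (e.shift i)).1.card_right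

/-- The virtual endomorphism of the semidirect product. -/
noncomputable def toVirtualEnd [Finite M] {σ : M →+ A} (hσ : ∀ b, ψ (σ b) = b) :
    VirtualEnd (D.CosetWreath A) where
  dom := e.dom
  finiteIndex := by
    refine ⟨?_⟩
    rw [e.index_dom hσ]
    exact mul_ne_zero Nat.card_pos.ne'
      (Finset.prod_ne_zero_iff.2 fun i _ => (D.finiteIndex (e.shift i)).index_ne_zero)
  hom := MonoidHom.mk'
    (fun x => wreathMk (e.map (base x.1)) fun i => D.f (e.shift i) ⟨x.1.right i, x.2.2 i⟩) (by
      intro x y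
      refine wreath_ext ?_ (funext fun i => ?_)
      · rw [base_mul]
        simp only [base_wreathMk, right_wreathMk]
        rw [Subgroup.coe_mul, base_mul, map_add, e.map_translate _ x.2.2]
      · exact map_mul (D.f (e.shift i)) ⟨x.1.right i, x.2.2 i⟩ ⟨y.1.right i, y.2.2 i⟩)

end CosetEnd

/-- The endomorphism of the semidirect product which sends the base group to the powers of a
diagonal element. -/
noncomputable def sumEnd (χ : A →+ ℤ) (c : G) : VirtualEnd (D.CosetWreath A) where
  dom := ⊤
  finiteIndex := inferInstance
  hom := (MonoidHom.mk' (fun x : D.CosetWreath A =>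
      (wreathMk 0 fun _ => c ^ χ (D.totalSum A (base x)) : D.CosetWreath A)) (by
    intro x y
    refine wreath_ext ?_ (funext fun i => ?_)
    · change 0 = 0 + D.translate A (fun _ => c ^ χ (D.totalSum A (base x))) 0
      rw [map_zero, add_zero]
    · rw [base_mul, map_add, totalSum_translate, map_add]
      exact zpow_add _ _ _)).comp (Subgroup.subtype ⊤)

end wreath

end GData

namespace GData

variable {G : Type*} [Group G] {s : ℕ} {D : GData G s} {A M : Type*} [AddCommGroup A]
  [AddCommGroup M] {q : ℕ}

theorem translate_pt_one (u : Fin s → G) (φ : D.CosetProd →₀ A) :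
    D.translate A u φ (D.pt 1) = φ (D.pt u) := by
  have : D.cosetProdPerm u (D.pt u) = D.pt 1 := by rw [cosetProdPerm_pt, mul_inv_cancel]
  rw [← this, translate_apply]

/-! ### Simplicity -/

/-- By `he` every `f k` acts on coordinate `i` for some `j`, so the projection of `K` to that
coordinate lies in the core of `D`. -/
theorem right_eq_one_of_preserves [Finite M] {ψ : A →+ M} {σ : M →+ A} (hσ : ∀ b, ψ (σ b) = b)
    (hD : D.IsSimple) {e : Fin s → D.CosetEnd A ψ} (he : ∀ i k, ∃ j, (e j).shift i = k)
    {K : Subgroup (D.CosetWreath A)} (hK : K.Normal)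
    (h : ∀ j, ((e j).toVirtualEnd hσ).Preserves K) {x : D.CosetWreath A} (hx : x ∈ K) :
    x.right = 1 := by
  funext i
  let π : D.CosetWreath A →* G := (Pi.evalMonoidHom (fun _ => G) i).comp SemidirectProduct.rightHom
  have hπ : Function.Surjective π := fun g =>
    ⟨wreathMk 0 fun _ => g, rfl⟩
  have hbot : K.map π = ⊥ := by
    refine eq_bot_of_invariant hD (hK.map π hπ) fun k => D.invariant_iff.2 ?_
    rintro _ ⟨y, hy, rfl⟩
    obtain ⟨j, rfl⟩ := he i k
    obtain ⟨h1, h2⟩ := h j y hy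
    exact ⟨h1.2 i, _, h2, rfl⟩
  have : π x ∈ K.map π := ⟨x, hx, rfl⟩
  rwa [hbot, mem_bot] at this

theorem isSimple_append [Finite M] (S : LatticeSplitting A M q) (hD : D.IsSimple)
    (e : Fin s → D.CosetEnd A S.ψ) (he : ∀ i k, ∃ j, (e j).shift i = k)
    {j₀ : Fin s} (hj₀ : (e j₀).map = D.push A) {c : G} (hc : Fin q → ¬ IsOfFinOrder c) :
    (VirtualEnd.toData (Fin.append (fun j => (e j).toVirtualEnd S.ψ_σ)
      fun k => sumEnd (D := D) (S.χ k) c)).IsSimple := by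
  refine isSimple_of_forall _ fun K hK h => ?_
  obtain ⟨h1, h2⟩ := VirtualEnd.toData_append_invariant h
  have hr : ∀ x ∈ K, x.right = 1 := fun x hx => right_eq_one_of_preserves S.ψ_σ hD he hK h1 hx
  have hχ : ∀ x ∈ K, ∀ k, S.χ k (D.totalSum A (base x)) = 0 := by
    intro x hx k
    obtain ⟨_, h4⟩ := h2 k x hx
    -- The image under `sumEnd` lies in `K`, so its diagonal part is trivial; any coordinate shows
    -- it.
    have h5 : c ^ S.χ k (D.totalSum A (base x)) = 1 := congrFun (hr _ h4) j₀
    by_contra hne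
    exact hc k (isOfFinOrder_iff_zpow_eq_one.2 ⟨_, hne, h5⟩)
  have hpush : ∀ x ∈ K, wreathMk (D.push A (base x)) 1 ∈ K := by
    intro x hx
    obtain ⟨h3, h4⟩ := h1 j₀ x hx
    have h5 := hr _ h4
    convert h4 using 1
    refine wreath_ext ?_ h5.symm
    rw [← hj₀]
    rfl
  have hiter : ∀ n, ∀ x ∈ K, wreathMk ((D.push A)^[n] (base x)) 1 ∈ K := by
    intro n
    induction n with
    | zero =>
      intro x hx
      convert hx using 1
      exact wreath_ext rfl (hr x hx).symm
    | succ n ih =>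
      intro x hx
      rw [Function.iterate_succ_apply]
      exact ih _ (hpush x hx)
  have hpt : ∀ x ∈ K, base x (D.pt 1) = 0 := by
    intro x hx
    obtain ⟨N, hN⟩ := push_iterate_eventually (base x)
    have h3 := hiter N x hx
    rw [hN N le_rfl] at h3
    -- The element `h3` of `K` is supported at the base point, so its total sum and its domain sum
    -- both read off this single value.
    refine S.eq_zero _ (fun k => ?_) ?_
    · have := hχ _ h3 k
      rwa [base_wreathMk, totalSum_single] at this
    · have := (h1 j₀ _ h3).1.1
      rwa [base_wreathMk, (e j₀).sum_single] at this
  intro x hx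
  refine wreath_ext (Finsupp.ext fun y => ?_) (hr x hx)
  obtain ⟨u, rfl⟩ := D.exists_pt y
  -- Conjugation by `u` brings the value at `D.pt u` to the base point.
  have h3 := hpt _ (hK.conj_mem x hx (wreathMk 0 u))
  rw [base_mul_mul_inv, base_wreathMk, right_wreathMk, map_zero, sub_zero, zero_add,
    translate_pt_one] at h3
  exact h3

/-! ### Finiteness of the states -/

theorem map_mem_supported {X : Type*} {P P' : Set X} (Q : (X →₀ A) →+ (X →₀ A))
    (hQ : ∀ x ∈ P, ∀ a, Q (Finsupp.single x a) ∈ Finsupp.supported A ℤ P') {φ : X →₀ A}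
    (hφ : φ ∈ Finsupp.supported A ℤ P) : Q φ ∈ Finsupp.supported A ℤ P' := by
  rw [← Finsupp.sum_single φ, Finsupp.sum, map_sum]
  exact Submodule.sum_mem _ fun x hx => hQ x ((Finsupp.mem_supported _ _).1 hφ hx) _

variable (D) in
/-- The points with representatives in `U`. -/
def points (U : Set G) : Set D.CosetProd := D.pt '' Set.pi Set.univ fun _ => U

theorem finite_points {U : Set G} (hU : U.Finite) : (D.points U).Finite :=
  (Set.Finite.pi fun _ => hU).image _

theorem pt_mem_points {U : Set G} {u : Fin s → G} (hu : ∀ i, u i ∈ U) : D.pt u ∈ D.points U :=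
  ⟨u, fun i _ => hu i, rfl⟩

variable (D) in
/-- The elements with components in `U`, with base part supported on the cosets of elements of `U`
and of total height at most `N`. -/
def box (S : LatticeSplitting A M q) (U : Set G) (N : ℕ) : Set (D.CosetWreath A) :=
  {x | (base x ∈ Finsupp.supported A ℤ (D.points U) ∧ S.totalHeight (base x) ≤ N) ∧
    ∀ i, x.right i ∈ U}

theorem finite_box [Finite M] (S : LatticeSplitting A M q) {U : Set G} (hU : U.Finite) (N : ℕ) :
    (D.box S U N).Finite := by
  refine Set.Finite.of_injOn (f := fun x => (base x, x.right)) (fun x hx => ?_) ?_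
    ((S.finite_supported_totalHeight_le (finite_points hU) N).prod
      (Set.Finite.pi fun _ : Fin s => hU))
  · exact ⟨hx.1, fun i _ => hx.2 i⟩
  · intro x _ y _ h
    exact wreath_ext (Prod.ext_iff.1 h).1 (Prod.ext_iff.1 h).2

theorem totalHeight_translate_le (S : LatticeSplitting A M q) (g : Fin s → G)
    (φ : D.CosetProd →₀ A) : S.totalHeight (D.translate A g φ) ≤ S.totalHeight φ :=
  S.totalHeight_map_le _ (fun x a => by rw [translate_single, S.totalHeight_single]) φ

theorem totalHeight_push_le (S : LatticeSplitting A M q) (φ : D.CosetProd →₀ A) :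
    S.totalHeight (D.push A φ) ≤ S.totalHeight φ := by
  refine S.totalHeight_map_le _ (fun x a => ?_) φ
  obtain ⟨u, rfl⟩ := D.exists_pt x
  by_cases hu : ∀ i, u i ∈ D.H i
  · rw [push_single_pt hu, S.totalHeight_single]
  · rw [push_single_of_notMem fun h => hu (pt_mem_block.1 h), S.totalHeight_zero]
    exact Nat.zero_le _

theorem push_translate_mem_supported {T : Fin s → Set G} (hT : D.IsTransversal T) {U : Set G}
    (hU : D.StatesClosed T U) {t : Fin s → G} (ht : ∀ i, t i ∈ T i) {φ : D.CosetProd →₀ A}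
    (hφ : φ ∈ Finsupp.supported A ℤ (D.points U)) :
    D.push A (D.translate A t φ) ∈ Finsupp.supported A ℤ (D.points U) := by
  refine map_mem_supported ((D.push A).comp (D.translate A t)) ?_ hφ
  rintro _ ⟨u, hu, rfl⟩ a
  rw [AddMonoidHom.comp_apply, translate_single, cosetProdPerm_pt]
  by_cases h : ∀ i, (u * t⁻¹) i ∈ D.H i
  · rw [push_single_pt h]
    refine Finsupp.single_mem_supported _ _ (pt_mem_points fun i => ?_)
    have h1 : 1 * u i * (t i)⁻¹ ∈ D.H i := by simpa using h i
    -- The new representative is the state of `u i` for the pair `(1, t i)`; this uses `1 ∈ T i`.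
    convert hU (u i) (hu i trivial) i 1 (hT i).2 (t i) (ht i) h1 using 3
    simp
  · rw [push_single_of_notMem fun h' => h (pt_mem_block.1 h')]
    exact zero_mem _

/-- Pushing and translating do not raise the height, and the values `σ b` contributed by the
transversal have height zero, so the same bound `N` survives. -/
theorem CosetEnd.statesClosed_box [Finite M] (S : LatticeSplitting A M q)
    (e : D.CosetEnd A S.ψ) {T : Fin s → Set G} (hT : D.IsTransversal T) {U : Set G}
    (hU : D.StatesClosed T U) (hU1 : 1 ∈ U) (hUi : ∀ x ∈ U, x⁻¹ ∈ U) (N : ℕ) :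
    (e.toVirtualEnd S.ψ_σ).StatesClosed (e.transversal S.σ T) (D.box S U N) := by
  rintro x ⟨⟨hx1, hx2⟩, hx3⟩ _ ⟨⟨b, t⟩, rfl⟩ _ ⟨⟨b', t'⟩, rfl⟩ h
  set y := (wreathMk (Finsupp.single (D.pt 1) (S.σ b)) fun i => (t i : G)) * x *
    (wreathMk (Finsupp.single (D.pt 1) (S.σ b')) fun i => (t' i : G))⁻¹
  have hr : ∀ i, y.right i ∈ D.H (e.shift i) := h.2
  have hstate : ∀ i, D.f (e.shift i) ⟨y.right i, hr i⟩ ∈ U := fun i =>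
    hU (x.right i) (hx3 i) (e.shift i) (t i) (t i).2 (t' i) (t' i).2 (hr i)
  refine ⟨?_, hstate⟩
  change e.map (base y) ∈ _ ∧ S.totalHeight (e.map (base y)) ≤ N
  rcases e.map_eq with h0 | ⟨hp, hs⟩
  · rw [h0, AddMonoidHom.zero_apply, S.totalHeight_zero]
    exact ⟨zero_mem _, Nat.zero_le _⟩
  -- The last term sits at the inverse of a state, whence the need for `U` to be closed under
  -- inverses.
  have h1 : e.map (base y) = Finsupp.single (D.pt 1) (S.σ b) +
      D.push A (D.translate A (fun i => (t i : G)) (base x)) +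
      -Finsupp.single (D.pt fun i => (D.f (e.shift i) ⟨y.right i, hr i⟩)⁻¹) (S.σ b') := by
    have h2 : base y = Finsupp.single (D.pt 1) (S.σ b) +
        D.translate A (fun i => (t i : G)) (base x) -
        D.translate A y.right (Finsupp.single (D.pt 1) (S.σ b')) := base_mul_mul_inv _ _ _
    refine (congrArg e.map h2).trans ?_
    rw [map_sub, e.map_translate _ hr, hp, map_add, push_single_one, push_single_one,
      translate_single, cosetProdPerm_pt, sub_eq_add_neg, one_mul]
    rfl
  rw [h1]
  constructor
  · refine add_mem (add_mem ?_ ?_) (neg_mem ?_)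
    · exact Finsupp.single_mem_supported _ _ (pt_mem_points fun i => hU1)
    · exact push_translate_mem_supported hT hU
        (fun i => by simpa only [hs, id] using (t i).2) hx1
    · exact Finsupp.single_mem_supported _ _ (pt_mem_points fun i => hUi _ (hstate i))
  · refine (S.totalHeight_add_le _ _).trans ?_
    rw [S.totalHeight_neg, S.totalHeight_single, S.height_σ, add_zero]
    refine (S.totalHeight_add_le _ _).trans ?_
    rw [S.totalHeight_single, S.height_σ, zero_add]
    exact ((totalHeight_push_le S _).trans (totalHeight_translate_le S _ _)).trans hx2

theorem natAbs_totalSum_le (S : LatticeSplitting A M q) (k : Fin q) (φ : D.CosetProd →₀ A) :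
    (S.χ k (D.totalSum A φ)).natAbs ≤ S.totalHeight φ := by
  have : D.totalSum A φ = ∑ x ∈ φ.support, φ x := by
    simp [totalSum, Finsupp.sum]
  rw [this, map_sum]
  refine (Int.natAbs_sum_le _ _).trans ?_
  exact Finset.sum_le_sum fun x _ => S.natAbs_χ_le k _

theorem statesClosed_sumEnd (S : LatticeSplitting A M q) (k : Fin q) (c : G) {U : Set G}
    {N : ℕ} (hU : ∀ n : ℤ, n.natAbs ≤ N → c ^ n ∈ U) :
    (sumEnd (D := D) (S.χ k) c).StatesClosed {1} (D.box S U N) := by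
  rintro x ⟨⟨hx1, hx2⟩, hx3⟩ t rfl t' rfl h
  refine ⟨⟨zero_mem _, ?_⟩, fun i => hU _ ?_⟩
  · exact S.totalHeight_zero.le.trans (Nat.zero_le _)
  · simp only [coe_subtype, one_mul, inv_one, mul_one]
    exact (natAbs_totalSum_le S k _).trans hx2

/-- The bound `N` is fixed by `x` beforehand, so only finitely many powers of `c` need to be placed
in `U`. -/
theorem exists_mem_box (S : LatticeSplitting A M q) {T : Fin s → Set G}
    (hT : ∀ g : G, ∃ U : Set G, U.Finite ∧ g ∈ U ∧ D.StatesClosed T U) (c : G)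
    (x : D.CosetWreath A) :
    ∃ (U : Set G) (N : ℕ), U.Finite ∧ D.StatesClosed T U ∧ 1 ∈ U ∧ (∀ g ∈ U, g⁻¹ ∈ U) ∧
      (∀ n : ℤ, n.natAbs ≤ N → c ^ n ∈ U) ∧ x ∈ D.box S U N := by
  choose rep hrep using D.exists_pt
  set N := S.totalHeight (base x)
  have hN : {n : ℤ | n.natAbs ≤ N}.Finite :=
    (Set.finite_Icc (-(N : ℤ)) N).subset fun n hn => by
      simp only [Set.mem_ofPred_eq] at hn
      simp only [Set.mem_Icc]
      omega
  obtain ⟨U, h1, h2, h3, h4⟩ := exists_finite_statesClosed hT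
    ((Set.finite_range x.right).union
      (((base x).support.finite_toSet.biUnion fun y _ => Set.finite_range (rep y)).union
        (hN.image fun n => c ^ n)))
  have hc : ∀ n : ℤ, n.natAbs ≤ N → c ^ n ∈ U := fun n hn => h2 (Or.inr (Or.inr ⟨n, hn, rfl⟩))
  refine ⟨U, N, h1, h4, ?_, h3, hc, ⟨?_, le_rfl⟩, fun i => h2 (Or.inl ⟨i, rfl⟩)⟩
  · simpa using hc 0 (Nat.zero_le _)
  · refine (Finsupp.mem_supported _ _).2 fun y hy => ?_
    rw [← hrep y]
    exact pt_mem_points fun i => h2 (Or.inr (Or.inl (Set.mem_biUnion hy ⟨i, rfl⟩)))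

theorem isFiniteState_append [Finite M] (S : LatticeSplitting A M q) (hD : D.IsFiniteState)
    (e : Fin s → D.CosetEnd A S.ψ) (c : G) :
    (VirtualEnd.toData (Fin.append (fun j => (e j).toVirtualEnd S.ψ_σ)
      fun k => sumEnd (D := D) (S.χ k) c)).IsFiniteState := by
  obtain ⟨T, hT, hU⟩ := hD
  refine VirtualEnd.toData_append_isFiniteState (fun j => (e j).transversal S.σ T)
    (fun _ => {1}) (fun j => ⟨(e j).isComplement_transversal S.ψ_σ hT,
      (e j).one_mem_transversal S.σ hT⟩) (fun k => ⟨?_, rfl⟩) fun x => ?_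
  · exact isComplement_univ_singleton
  · obtain ⟨U, N, h1, h2, h3, h4, h5, h6⟩ := exists_mem_box S hU c x
    exact ⟨D.box S U N, finite_box S h1 N, h6,
      fun j => (e j).statesClosed_box S hT h2 h3 h4 N, fun k => statesClosed_sumEnd S k c h5⟩

/-! ### The data of the semidirect product -/

/-- Simple data for the semidirect product, with their orbit-type. -/
theorem exists_wreathData [Finite M] (S : LatticeSplitting A M q) (hD : D.IsSimple) (hs : 0 < s)
    {c : G} (hc : Fin q → ¬ IsOfFinOrder c) :
    ∃ E : GData (D.CosetWreath A) (s + q),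
      E.HasOrbitType (Fin.append (fun _ => Nat.card M * ∏ i, (D.H i).index) fun _ => 1) ∧
      E.IsSimple ∧ (D.IsFiniteState → E.IsFiniteState) := by
  have : NeZero s := ⟨hs.ne'⟩
  -- The `j`-th map uses `f (i + j)` on coordinate `i`. Each shift is a permutation, so all `s`
  -- domains have the same index; `f k` meets coordinate `i` for `j = k - i`.
  let e : Fin s → D.CosetEnd A S.ψ := fun j =>
    if j = 0 then D.pushEnd S.ψ else D.shiftEnd S.ψ (Equiv.addRight j)
  have he : ∀ j, (e j).shift = Equiv.addRight j := by
    intro j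
    by_cases hj : j = 0
    · subst hj
      funext i
      simp [e, pushEnd]
    · simp [e, hj, shiftEnd]
  refine ⟨_, ?_, isSimple_append S hD e (fun i k => ⟨k - i, ?_⟩) (j₀ := 0) ?_ hc,
    fun h => isFiniteState_append S h e c⟩
  · intro i
    change (Fin.append (fun j => (e j).toVirtualEnd S.ψ_σ)
      (fun k => sumEnd (D := D) (S.χ k) c) i).dom.index = _
    refine Fin.addCases (fun j => ?_) (fun k => ?_) i
    · rw [Fin.append_left, Fin.append_left]
      refine ((e j).index_dom S.ψ_σ).trans ?_
      rw [he j]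
      congr 1
      exact Equiv.prod_comp (Equiv.addRight j) fun i => (D.H i).index
    · rw [Fin.append_right, Fin.append_right]
      exact index_top
  · rw [he]
    simp
  · simp [e, pushEnd]

/-- With no maps at all, `G` itself is vacuously invariant. -/
theorem pos_of_nontrivial [Nontrivial G] (hD : D.IsSimple) : 0 < s := by
  by_contra h
  obtain rfl : s = 0 := by omega
  exact top_ne_bot (eq_bot_of_invariant hD (K := (⊤ : Subgroup G)) inferInstance
    fun i => i.elim0)

end GData
end

theorem theoremB {G : Type*} [Group G] {s : ℕ} (D : GData G s) (hD : D.IsSimple)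
    (A : Type*) [AddCommGroup A] [AddGroup.FG A] (B : Type*) [AddCommGroup B] [Finite B] :
    -- the group built from `A` is self-similar, and finite-state if `G` is
    ((∃ x : G, ¬ IsOfFinOrder x) →
      (∃ (r : ℕ) (E : GData (D.CosetWreath A) r),
        E.IsSimple ∧ (D.IsFiniteState → E.IsFiniteState)) ∧
      (∃ n : ℕ, 2 ≤ n ∧ ∃ φ : D.CosetWreath A →* TreeAut (Fin n),
        Function.Injective φ ∧ TreeAut.IsSelfSimilar φ.range ∧
        (D.IsFiniteState → ∀ x, TreeAut.IsFiniteState (φ x)))) ∧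
    -- the orbit-type for a finite abelian group `B`, when all `H i` coincide
    (∀ m : ℕ, 0 < s → D.HasOrbitType (fun _ => m) → (⨅ i, D.H i).index = m →
      ∃ E : GData (D.CosetWreath B) s,
        E.HasOrbitType (fun _ => Nat.card B * m ^ s) ∧ E.IsSimple ∧
        (D.IsFiniteState → E.IsFiniteState)) ∧
    -- the orbit-type for `ℤ`, when all `H i` coincide
    (∀ m : ℕ, (∃ x : G, ¬ IsOfFinOrder x) → D.HasOrbitType (fun _ => m) → (⨅ i, D.H i).index = m →
      ∃ E : GData (D.CosetWreath ℤ) (s + 1),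
        E.HasOrbitType (Fin.snoc (fun _ : Fin s => m ^ s) 1) ∧ E.IsSimple ∧
        (D.IsFiniteState → E.IsFiniteState)) := by
  have nontriv : (∃ x : G, ¬ IsOfFinOrder x) → Nontrivial G := fun ⟨x, hx⟩ =>
    ⟨x, 1, fun h => hx (h ▸ IsOfFinOrder.one)⟩
  refine ⟨fun hx => ?_, fun m hs hm _ => ?_, fun m hx hm _ => ?_⟩
  · have := nontriv hx
    have hs := GData.pos_of_nontrivial hD
    obtain ⟨c, hc⟩ := hx
    obtain ⟨q, M, _, _, ⟨S⟩⟩ := LatticeSplitting.exists_of_fg A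
    obtain ⟨E, -, hE, hE'⟩ := GData.exists_wreathData S hD hs fun _ => hc
    refine ⟨⟨_, E, hE, hE'⟩, ?_⟩
    have : Nontrivial (D.CosetWreath A) := by
      refine ⟨GData.wreathMk 0 fun _ => c, 1, fun h => hc ?_⟩
      have h1 : c = 1 := congrFun (congrArg SemidirectProduct.right h) ⟨0, hs⟩
      exact h1 ▸ IsOfFinOrder.one
    obtain ⟨n, hn, φ, h1, h2, h3⟩ := hE.exists_treeAut
    exact ⟨n, hn, φ, h1, h2, fun h => h3 (hE' h)⟩
  · obtain ⟨E, h1, h2, h3⟩ :=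
      -- The lattice rank is zero, so no `sumEnd` occurs and `c` is a dummy.
      GData.exists_wreathData (LatticeSplitting.ofFinite B) hD hs (c := 1) fun k => k.elim0
    refine ⟨E, fun i => (h1 (Fin.castAdd 0 i)).trans ?_, h2, h3⟩
    rw [Fin.append_left, Finset.prod_congr rfl fun i _ => hm i, Finset.prod_const,
      Finset.card_univ, Fintype.card_fin]
  · have := nontriv hx
    have hs := GData.pos_of_nontrivial hD
    obtain ⟨c, hc⟩ := hx
    -- Here `M` is trivial and the rank is one: the single `sumEnd`, with full domain, gives the
    -- final entry `1`.
    obtain ⟨E, h1, h2, h3⟩ := GData.exists_wreathData LatticeSplitting.int hD hs fun _ => hc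
    refine ⟨E, fun i => (h1 i).trans ?_, h2, h3⟩
    refine Fin.lastCases ?_ (fun j => ?_) i
    · rw [Fin.snoc_last]
      exact Fin.append_right _ _ (0 : Fin 1)
    · rw [Fin.snoc_castSucc]
      refine (Fin.append_left _ _ j).trans ?_
      rw [Finset.prod_congr rfl fun i _ => hm i, Finset.prod_const,
        Finset.card_univ, Fintype.card_fin, Nat.card_unique, one_mul]
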